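/- \textbf{Theorem (Consistent active variable selection for the Adaptive Transfer Lasso).} Fix $p$, $\beta^*\in\mathbb{R}^p$, $\sigma\ge 0$ and $\gamma_1,\gamma_2\ge 0$, and let $S:=\{j:\beta^*_j\ne 0\}$. For each $n$ let $X=X_n\in\mathbb{R}^{n\times p}$ be a deterministic matrix with rows $x_1,\dots,x_n$, and let $y=X\beta^*+\varepsilon$, where $\varepsilon_1,\dots,\varepsilon_n$ are i.i.d. $\mathcal N(0,\sigma^2)$. Suppose that, as $n\to\infty$, $\frac1n X^\top X\to C$ with $C$ positive definite and $\frac1n\max_i\|x_i\|_2^2\to 0$. Let $m=m_n$ be integers, positive for all large $n$, with $n/m\to r_0$ for some $r_0\in[0,\infty)$. Let $\tilde\beta=\tilde\beta_n$ be a random vector in $\mathbb{R}^p$, independent of $\varepsilon$, such that $\sqrt m(\tilde\beta-\beta^*)$ converges in distribution to some probability law on $\mathbb{R}^p$. Let $\lambda_n,\eta_n\ge 0$ be deterministic, and let the estimator $\hat\beta_n$ be a random vector which is almost surely a minimizer over $\beta\in\mathbb{R}^p$ of \[ \frac1n\|y-X\beta\|_2^2+\frac{\lambda_n}{n}\sum_{j=1}^p\frac{|\beta_j|}{|\tilde\beta_j|^{\gamma_1}}+\frac{\eta_n}{n}\sum_{j=1}^p|\tilde\beta_j|^{\gamma_2}\,|\beta_j-\tilde\beta_j|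 , \] with the conventions $0^0=1$, $1/0=\infty$ and $0\cdot\infty=0$. Assume that one of the following holds as $n\to\infty$: (ii) $\sqrt{m^{\gamma_1}/n}\,\lambda_n\to\infty$, $\eta_n/\sqrt n\to\infty$, $\eta_n/\lambda_n\to\infty$ and $\eta_n/(\sqrt{m^{\gamma_1+\gamma_2}}\,\lambda_n)\to 0$; (v) $\sqrt{m^{\gamma_1}/n}\,\lambda_n\to\infty$, $\lambda_n/\sqrt n\to\lambda_0$ and $\eta_n/\sqrt n\to\eta_0$ for some $\lambda_0,\eta_0\in[0,\infty)$; (vi) $\gamma_1>0$, $\lambda_n/\sqrt n\to\infty$, $\lambda_n/n\to 0$ and $\eta_n/\lambda_n\to 0$. Then the true support is recovered with probability tending to one: \[ P\bigl(\{j:\hat\beta_{n,j}\ne 0\}=S\bigr)\to 1\qquad(n\to\infty). \] -/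

import Mathlib

open MeasureTheory ProbabilityTheory Filter Topology
open scoped NNReal ENNReal Matrix

namespace AdaptiveTransferLasso

/-- The weight `v_j = 1 / |β̃_j| ^ γ₁`, with values in `[0, ∞]`.  It is `∞` when `β̃_j = 0` and
`γ₁ > 0` (an infinite penalty on `β_j ≠ 0`), and it is `1` when `γ₁ = 0`. -/
noncomputable def lassoWeight (γ₁ : ℝ) (b : ℝ) : ℝ≥0∞ :=
  (ENNReal.ofReal |b| ^ γ₁)⁻¹

/-- The weight `w_j = |β̃_j| ^ γ₂` (equal to `1` when `γ₂ = 0`). -/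
noncomputable def transferWeight (γ₂ : ℝ) (b : ℝ) : ℝ≥0∞ :=
  ENNReal.ofReal |b| ^ γ₂

/-- The objective function, with values in `[0, ∞]`:
`(1/n) ‖y - X β‖₂² + (lam/n) ∑ⱼ v_j |β_j| + (eta/n) ∑ⱼ w_j |β_j - β̃_j|`.
Here `0 * ∞ = 0`, so an infinite weight `v_j` costs nothing exactly when `β_j = 0`
(provided `lam > 0`). -/
noncomputable def objective {n p : ℕ} (X : Matrix (Fin n) (Fin p) ℝ) (y : Fin n → ℝ)
    (lam eta γ₁ γ₂ : ℝ) (init : Fin p → ℝ) (β : Fin p → ℝ) : ℝ≥0∞ :=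
  ENNReal.ofReal ((1 / (n : ℝ)) * ∑ i, (y i - (X *ᵥ β) i) ^ 2)
    + ENNReal.ofReal (lam / n) * ∑ j, lassoWeight γ₁ (init j) * ENNReal.ofReal |β j|
    + ENNReal.ofReal (eta / n) * ∑ j, transferWeight γ₂ (init j) * ENNReal.ofReal |β j - init j|

/-- `β` is an Adaptive Transfer Lasso estimate: a global minimiser of the objective. -/
def IsEstimate {n p : ℕ} (X : Matrix (Fin n) (Fin p) ℝ) (y : Fin n → ℝ)
    (lam eta γ₁ γ₂ : ℝ) (init : Fin p → ℝ) (β : Fin p → ℝ) : Prop :=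
  IsMinOn (objective X y lam eta γ₁ γ₂ init) Set.univ β

/-- `√(m^γ₁ / n) λ_n → ∞`, `η_n / √n → ∞`, `η_n / λ_n → ∞` and
`η_n / (√(m^(γ₁+γ₂)) λ_n) → 0`. -/
def RootMRegime (m : ℕ → ℕ) (lam eta : ℕ → ℝ) (γ₁ γ₂ : ℝ) : Prop :=
  Tendsto (fun n : ℕ => √((m n : ℝ) ^ γ₁ / n) * lam n) atTop atTop ∧
  Tendsto (fun n : ℕ => eta n / √(n : ℝ)) atTop atTop ∧
  Tendsto (fun n : ℕ => eta n / lam n) atTop atTop ∧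
  Tendsto (fun n : ℕ => eta n / (√((m n : ℝ) ^ (γ₁ + γ₂)) * lam n)) atTop (𝓝 0)

/-- `√(m^γ₁ / n) λ_n → ∞`, `λ_n / √n → λ₀ ≥ 0` and `η_n / √n → η₀ ≥ 0`. -/
def RootNRegime (m : ℕ → ℕ) (lam eta : ℕ → ℝ) (γ₁ : ℝ) : Prop :=
  Tendsto (fun n : ℕ => √((m n : ℝ) ^ γ₁ / n) * lam n) atTop atTop ∧
  (∃ lam₀ : ℝ, 0 ≤ lam₀ ∧ Tendsto (fun n : ℕ => lam n / √(n : ℝ)) atTop (𝓝 lam₀)) ∧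
  (∃ eta₀ : ℝ, 0 ≤ eta₀ ∧ Tendsto (fun n : ℕ => eta n / √(n : ℝ)) atTop (𝓝 eta₀))

/-- `λ_n / √n → ∞`, `λ_n / n → 0` and `λ_n / η_n → ∞`.  The last condition is written as
`η_n / λ_n → 0`, so that `η_n = 0` is allowed. -/
def SubRootNRegime (lam eta : ℕ → ℝ) : Prop :=
  Tendsto (fun n : ℕ => lam n / √(n : ℝ)) atTop atTop ∧
  Tendsto (fun n : ℕ => lam n / (n : ℝ)) atTop (𝓝 0) ∧
  Tendsto (fun n : ℕ => eta n / lam n) atTop (𝓝 0)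

/-- Consistent active variable selection: `P(Ŝ_n = S) → 1`. -/
def ConsistentActiveSelection {Ω : Type*} [MeasurableSpace Ω] (μ : Measure Ω) {p : ℕ}
    (est : ℕ → Ω → Fin p → ℝ) (βstar : Fin p → ℝ) : Prop :=
  Tendsto (fun n => μ {ω | Function.support (est n ω) = Function.support βstar}) atTop (𝓝 1)

end AdaptiveTransferLasso

/-! Randomness enters only through the event that `‖β̃ - β*‖ ≤ K / √m` and `‖Xᵀ ε‖ ≤ K √n` in sup
norm. For large `K` its probability is eventually close to one, by tightness of `√m (β̃ - β*)` and
Chebyshev. On this event support recovery is deterministic for large `n` (`SelectsWithin`).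

The deterministic tool is `basic_inequality`, which compares the minimiser with a chosen vector `b`.
If each coordinate's penalty increment exceeds what the score at `b` can gain, the minimiser is `b`
itself (`eq_of_penaltyIncrement_ge`). Off `S` the initial estimate is `O(1/√m)`, so the lasso weight
is at least of order `m^(γ₁/2)`; on `S` both weights stay bounded above and away from zero.

In the first regime take `b = β̃` on `S` and `0` elsewhere. The transfer penalty wins on `S` and the
lasso penalty wins off `S`, so the estimator equals this `b`, whose support is `S`.

The other two regimes reduce to `Dominated`. With `ρ = √n + λ + η`, comparison with `β*` gives the
rate `O(ρ/n) = o(1)`, which rules out false zeros (`norm_sub_le`). Then `b` is the estimator with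
its coordinates off `S` set to zero: the score there is `O(ρ)`, the lasso penalty off `S` is of
larger order, and so the estimator equals `b`. -/

namespace AdaptiveTransferLasso

/-! ### Reduction to a real objective and comparison inequalities -/

section RealObjective

variable {n p : ℕ} {X : Matrix (Fin n) (Fin p) ℝ} {y : Fin n → ℝ} {lam eta γ₁ γ₂ : ℝ}
  {init β b : Fin p → ℝ}

/-- The real-valued version of `objective`; the two agree at every `β` that vanishes where the
weight `v_j` is infinite. -/
noncomputable def realObjective (X : Matrix (Fin n) (Fin p) ℝ) (y : Fin n → ℝ)
    (lam eta γ₁ γ₂ : ℝ) (init : Fin p → ℝ) (β : Fin p → ℝ) : ℝ :=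
  (1 / (n : ℝ)) * ∑ i, (y i - (X *ᵥ β) i) ^ 2
    + (lam / n) * ∑ j, (|init j| ^ γ₁)⁻¹ * |β j|
    + (eta / n) * ∑ j, |init j| ^ γ₂ * |β j - init j|

lemma lassoWeight_eq (hγ₁ : 0 ≤ γ₁) (x : ℝ) :
    lassoWeight γ₁ x = (ENNReal.ofReal (|x| ^ γ₁))⁻¹ := by
  rw [lassoWeight, ENNReal.ofReal_rpow_of_nonneg (abs_nonneg x) hγ₁]

lemma transferWeight_eq (hγ₂ : 0 ≤ γ₂) (x : ℝ) :
    transferWeight γ₂ x = ENNReal.ofReal (|x| ^ γ₂) := by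
  rw [transferWeight, ENNReal.ofReal_rpow_of_nonneg (abs_nonneg x) hγ₂]

lemma objective_eq_ofReal (hγ₁ : 0 ≤ γ₁) (hγ₂ : 0 ≤ γ₂) (hlam : 0 ≤ lam) (heta : 0 ≤ eta)
    (h : ∀ j, |init j| ^ γ₁ = 0 → β j = 0) :
    objective X y lam eta γ₁ γ₂ init β
      = ENNReal.ofReal (realObjective X y lam eta γ₁ γ₂ init β) := by
  have h1 : ∀ j, lassoWeight γ₁ (init j) * ENNReal.ofReal |β j|
      = ENNReal.ofReal ((|init j| ^ γ₁)⁻¹ * |β j|) := by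
    intro j
    rw [lassoWeight_eq hγ₁]
    by_cases h0 : |init j| ^ γ₁ = 0
    · simp [h j h0]
    · have : 0 < |init j| ^ γ₁ := lt_of_le_of_ne (by positivity) (Ne.symm h0)
      rw [ENNReal.ofReal_mul (by positivity), ENNReal.ofReal_inv_of_pos this]
  have h2 : ∀ j, transferWeight γ₂ (init j) * ENNReal.ofReal |β j - init j|
      = ENNReal.ofReal (|init j| ^ γ₂ * |β j - init j|) := by
    intro j
    rw [transferWeight_eq hγ₂, ENNReal.ofReal_mul (by positivity)]
  rw [objective, realObjective]
  simp only [h1, h2]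
  rw [← ENNReal.ofReal_sum_of_nonneg (fun j _ => by positivity),
    ← ENNReal.ofReal_sum_of_nonneg (fun j _ => by positivity),
    ← ENNReal.ofReal_mul (by positivity), ← ENNReal.ofReal_mul (by positivity),
    ← ENNReal.ofReal_add (by positivity) (by positivity),
    ← ENNReal.ofReal_add (by positivity) (by positivity)]

lemma eq_zero_of_objective_ne_top (hγ₁ : 0 ≤ γ₁) (hlam : 0 < lam) (hn : 0 < n)
    (h : objective X y lam eta γ₁ γ₂ init β ≠ ⊤) (j : Fin p) (hj : |init j| ^ γ₁ = 0) :
    β j = 0 := by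
  by_contra hβ
  apply h
  have hn' : (0 : ℝ) < n := by exact_mod_cast hn
  have h1 : lassoWeight γ₁ (init j) * ENNReal.ofReal |β j| = ⊤ := by
    rw [lassoWeight_eq hγ₁, hj, ENNReal.ofReal_zero, ENNReal.inv_zero,
      ENNReal.top_mul (by simpa using hβ)]
  have h2 : ∑ j, lassoWeight γ₁ (init j) * ENNReal.ofReal |β j| = ⊤ :=
    ENNReal.sum_eq_top.2 ⟨j, Finset.mem_univ j, h1⟩
  rw [objective, h2, ENNReal.mul_top (by simpa using div_pos hlam hn')]
  simp

/-- A minimiser vanishes where `v_j` is infinite, and minimises the real-valued objective among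
the vectors which do so. -/
lemma IsEstimate.eq_zero_and_realObjective_le (hγ₁ : 0 ≤ γ₁) (hγ₂ : 0 ≤ γ₂) (hlam : 0 < lam)
    (heta : 0 ≤ eta) (hn : 0 < n) (hβ : IsEstimate X y lam eta γ₁ γ₂ init β)
    (hb : ∀ j, |init j| ^ γ₁ = 0 → b j = 0) :
    (∀ j, |init j| ^ γ₁ = 0 → β j = 0) ∧
      realObjective X y lam eta γ₁ γ₂ init β ≤ realObjective X y lam eta γ₁ γ₂ init b := by
  have hle : objective X y lam eta γ₁ γ₂ init β ≤ objective X y lam eta γ₁ γ₂ init b :=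
    hβ (Set.mem_univ b)
  have hbr := objective_eq_ofReal (X := X) (y := y) hγ₁ hγ₂ hlam.le heta hb
  rw [hbr] at hle
  have hz := eq_zero_of_objective_ne_top (X := X) (y := y) (eta := eta) (γ₂ := γ₂)
    hγ₁ hlam hn (ne_top_of_le_ne_top ENNReal.ofReal_ne_top hle)
  refine ⟨hz, ?_⟩
  rw [objective_eq_ofReal hγ₁ hγ₂ hlam.le heta hz] at hle
  refine (ENNReal.ofReal_le_ofReal_iff ?_).1 hle
  unfold realObjective
  have := hlam.le
  positivity

/-- The change of the two penalties in the coordinate `j`, when `b` is replaced by `β`. -/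
noncomputable def penaltyIncrement (lam eta γ₁ γ₂ : ℝ) (init β b : Fin p → ℝ) (j : Fin p) : ℝ :=
  lam * ((|init j| ^ γ₁)⁻¹ * (|β j| - |b j|))
    + eta * (|init j| ^ γ₂ * (|β j - init j| - |b j - init j|))

/-- Expanding the residual sum of squares around `b` is exact, so optimality against `b` gives this
after multiplication by `n`. The vector paired with `β - b` is the score at `b`. -/
lemma basic_inequality (hγ₁ : 0 ≤ γ₁) (hγ₂ : 0 ≤ γ₂) (hlam : 0 < lam)
    (heta : 0 ≤ eta) (hn : 0 < n) {βstar : Fin p → ℝ} {e : Fin n → ℝ}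
    (hβ : IsEstimate X (X *ᵥ βstar + e) lam eta γ₁ γ₂ init β)
    (hb : ∀ j, |init j| ^ γ₁ = 0 → b j = 0) :
    (β - b) ⬝ᵥ ((Xᵀ * X) *ᵥ (β - b))
      - 2 * ((β - b) ⬝ᵥ (Xᵀ *ᵥ e - (Xᵀ * X) *ᵥ (b - βstar)))
      + ∑ j, penaltyIncrement lam eta γ₁ γ₂ init β b j ≤ 0 := by
  have hn' : (0 : ℝ) < n := by exact_mod_cast hn
  have key := (hβ.eq_zero_and_realObjective_le hγ₁ hγ₂ hlam heta hn hb).2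
  have hdot : ∀ v : Fin n → ℝ, ∑ i, v i ^ 2 = v ⬝ᵥ v := fun v => by
    simp [dotProduct, sq]
  have hT : ∀ (u : Fin p → ℝ) (w : Fin n → ℝ), u ⬝ᵥ (Xᵀ *ᵥ w) = (X *ᵥ u) ⬝ᵥ w := fun u w => by
    rw [Matrix.dotProduct_mulVec, Matrix.vecMul_transpose]
  have hrss : ∑ i, ((X *ᵥ βstar + e) i - (X *ᵥ β) i) ^ 2
      - ∑ i, ((X *ᵥ βstar + e) i - (X *ᵥ b) i) ^ 2
      = (β - b) ⬝ᵥ ((Xᵀ * X) *ᵥ (β - b))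
      - 2 * ((β - b) ⬝ᵥ (Xᵀ *ᵥ e - (Xᵀ * X) *ᵥ (b - βstar))) := by
    rw [← Matrix.mulVec_mulVec, ← Matrix.mulVec_mulVec, ← Matrix.mulVec_sub, hT, hT]
    simp only [Matrix.mulVec_sub, dotProduct, ← Finset.sum_sub_distrib, Finset.mul_sum]
    refine Finset.sum_congr rfl fun i _ => ?_
    simp only [Pi.sub_apply, Pi.add_apply]
    ring
  have hpen : ∑ j, penaltyIncrement lam eta γ₁ γ₂ init β b j
      = lam * (∑ j, (|init j| ^ γ₁)⁻¹ * |β j| - ∑ j, (|init j| ^ γ₁)⁻¹ * |b j|)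
        + eta * (∑ j, |init j| ^ γ₂ * |β j - init j| - ∑ j, |init j| ^ γ₂ * |b j - init j|) := by
    simp only [penaltyIncrement, Finset.sum_add_distrib, Finset.mul_sum,
      ← Finset.sum_sub_distrib, mul_sub]
  rw [← hrss, hpen]
  unfold realObjective at key
  have e1 : ∀ a c d : ℝ, (1 / (n : ℝ)) * a + lam / n * c + eta / n * d
      = (a + lam * c + eta * d) / n := fun a c d => by field_simp
  rw [e1, e1, div_le_div_iff_of_pos_right hn'] at key
  linarith

/-- If moving away from `b` raises the penalty faster than the score at `b` can compensate,
then the minimiser is `b`. -/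
lemma eq_of_penaltyIncrement_ge (hγ₁ : 0 ≤ γ₁) (hγ₂ : 0 ≤ γ₂) (hlam : 0 < lam)
    (heta : 0 ≤ eta) (hn : 0 < n) {βstar : Fin p → ℝ} {e : Fin n → ℝ}
    (hβ : IsEstimate X (X *ᵥ βstar + e) lam eta γ₁ γ₂ init β)
    (hb : ∀ j, |init j| ^ γ₁ = 0 → b j = 0) {r : ℝ}
    (hr : ∀ j, |(Xᵀ *ᵥ e - (Xᵀ * X) *ᵥ (b - βstar)) j| ≤ r)
    (hpen : ∀ j, (2 * r + 1) * |β j - b j| ≤ penaltyIncrement lam eta γ₁ γ₂ init β b j) :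
    β = b := by
  have key := basic_inequality hγ₁ hγ₂ hlam heta hn hβ hb
  have hquad : 0 ≤ (β - b) ⬝ᵥ ((Xᵀ * X) *ᵥ (β - b)) := by
    rw [← Matrix.mulVec_mulVec, Matrix.dotProduct_mulVec, Matrix.vecMul_transpose]
    exact Finset.sum_nonneg fun i _ => mul_self_nonneg _
  have hcross : (β - b) ⬝ᵥ (Xᵀ *ᵥ e - (Xᵀ * X) *ᵥ (b - βstar)) ≤ ∑ j, r * |β j - b j| := by
    refine Finset.sum_le_sum fun j _ => (le_abs_self _).trans ?_
    rw [abs_mul, mul_comm]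
    exact mul_le_mul_of_nonneg_right (hr j) (abs_nonneg _)
  have hsum := Finset.sum_le_sum fun j (_ : j ∈ Finset.univ) => hpen j
  rw [← Finset.mul_sum] at hcross hsum
  -- The score costs at most `2r` per unit of ℓ¹ distance, and the penalty returns `2r + 1`; the
  -- surplus `1` forces the distance to vanish.
  have h0 : ∑ j, |β j - b j| ≤ 0 := by nlinarith
  funext j
  have h1 : |β j - b j| ≤ 0 :=
    (Finset.single_le_sum (f := fun j => |β j - b j|) (fun j _ => abs_nonneg _)
      (Finset.mem_univ j)).trans h0
  exact sub_eq_zero.1 (abs_nonpos_iff.1 h1)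

end RealObjective

/-! ### Penalty increments and the rate of convergence -/

section Deterministic

variable {n p : ℕ} {X : Matrix (Fin n) (Fin p) ℝ} {lam eta γ₁ γ₂ : ℝ} {init β b : Fin p → ℝ}

/-- Used off the true support: a small initial value makes the lasso weight large and bounds the
transfer weight, so leaving zero costs more lasso penalty than the transfer term refunds. -/
lemma penaltyIncrement_ge_of_init_small (hγ₁ : 0 ≤ γ₁) (hγ₂ : 0 ≤ γ₂) (hlam : 0 ≤ lam)
    (heta : 0 ≤ eta) {K s t : ℝ} (hK : 0 < K) (hs : 0 < s) {j : Fin p}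
    (hinit : |init j| ≤ K / s) (hβ : |init j| ^ γ₁ = 0 → β j = 0) (hb : b j = 0)
    (ht : K ^ γ₁ * (t + K ^ γ₂ * (eta / s ^ γ₂)) ≤ lam * s ^ γ₁) :
    t * |β j - b j| ≤ penaltyIncrement lam eta γ₁ γ₂ init β b j := by
  -- An infinite weight becomes the real number `0⁻¹ = 0` here; this is harmless because both
  -- coordinates then vanish.
  by_cases h0 : |init j| ^ γ₁ = 0
  · simp [penaltyIncrement, hβ h0, hb]
  have hpos : 0 < |init j| ^ γ₁ := lt_of_le_of_ne (by positivity) (Ne.symm h0)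
  have hv : (K ^ γ₁)⁻¹ * s ^ γ₁ ≤ (|init j| ^ γ₁)⁻¹ := by
    have : |init j| ^ γ₁ ≤ K ^ γ₁ / s ^ γ₁ := by
      rw [← Real.div_rpow hK.le hs.le]
      exact Real.rpow_le_rpow (abs_nonneg _) hinit hγ₁
    have h2 := inv_anti₀ hpos this
    rwa [inv_div, div_eq_inv_mul] at h2
  have hw : |init j| ^ γ₂ ≤ K ^ γ₂ / s ^ γ₂ := by
    rw [← Real.div_rpow hK.le hs.le]
    exact Real.rpow_le_rpow (abs_nonneg _) hinit hγ₂
  have hKp : 0 < K ^ γ₁ := by positivity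
  have hcoef : t ≤ lam * (|init j| ^ γ₁)⁻¹ - eta * |init j| ^ γ₂ := by
    have h1 : t + K ^ γ₂ * (eta / s ^ γ₂) ≤ lam * ((K ^ γ₁)⁻¹ * s ^ γ₁) := by
      rw [mul_left_comm, ← div_eq_inv_mul, le_div_iff₀ hKp, mul_comm]
      exact ht
    have h2 := mul_le_mul_of_nonneg_left hv hlam
    have h3 := mul_le_mul_of_nonneg_left hw heta
    have h4 : eta * (K ^ γ₂ / s ^ γ₂) = K ^ γ₂ * (eta / s ^ γ₂) := by ring
    linarith
  have htri : -|β j| ≤ |β j - init j| - |0 - init j| := by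
    have := abs_sub_abs_le_abs_sub (init j) (init j - β j)
    rw [abs_sub_comm (init j) (β j)] at this
    simp only [sub_sub_cancel, zero_sub, abs_neg] at this ⊢
    linarith
  rw [penaltyIncrement, hb, abs_zero, sub_zero, sub_zero]
  have h5 := mul_le_mul_of_nonneg_left htri
    (mul_nonneg heta (Real.rpow_nonneg (abs_nonneg (init j)) γ₂))
  have h6 := mul_le_mul_of_nonneg_right hcoef (abs_nonneg (β j))
  nlinarith

/-- Used on the true support in the first regime: the transfer term has its kink at `init j`, and
its slope beats that of the lasso term. -/
lemma penaltyIncrement_ge_of_eq_init (hlam : 0 ≤ lam) (heta : 0 ≤ eta) {V W t : ℝ} {j : Fin p}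
    (hb : b j = init j) (hV : (|init j| ^ γ₁)⁻¹ ≤ V) (hW : W ≤ |init j| ^ γ₂)
    (ht : t + lam * V ≤ eta * W) :
    t * |β j - b j| ≤ penaltyIncrement lam eta γ₁ γ₂ init β b j := by
  have hcoef : t ≤ eta * |init j| ^ γ₂ - lam * (|init j| ^ γ₁)⁻¹ := by
    have h2 := mul_le_mul_of_nonneg_left hV hlam
    have h3 := mul_le_mul_of_nonneg_left hW heta
    linarith
  have htri : -|β j - init j| ≤ |β j| - |init j| := by
    have := abs_sub_abs_le_abs_sub (init j) (β j)
    rw [abs_sub_comm] at this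
    linarith
  rw [penaltyIncrement, hb, sub_self, abs_zero, sub_zero]
  have h5 := mul_le_mul_of_nonneg_left htri
    (mul_nonneg hlam (inv_nonneg.2 (Real.rpow_nonneg (abs_nonneg (init j)) γ₁)))
  have h6 := mul_le_mul_of_nonneg_right hcoef (abs_nonneg (β j - init j))
  nlinarith

/-- The penalty is Lipschitz where the lasso weight is bounded. Where `b j = 0` that weight may be
arbitrarily large, since the lasso term cannot decrease there. -/
lemma neg_le_penaltyIncrement (hlam : 0 ≤ lam) (heta : 0 ≤ eta) {V W : ℝ} {j : Fin p}
    (hV0 : 0 ≤ V) (hV : b j = 0 ∨ (|init j| ^ γ₁)⁻¹ ≤ V) (hW : |init j| ^ γ₂ ≤ W) :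
    -((lam * V + eta * W) * |β j - b j|) ≤ penaltyIncrement lam eta γ₁ γ₂ init β b j := by
  have hv0 : 0 ≤ (|init j| ^ γ₁)⁻¹ := inv_nonneg.2 (Real.rpow_nonneg (abs_nonneg (init j)) γ₁)
  have h1 : -(V * |β j - b j|) ≤ (|init j| ^ γ₁)⁻¹ * (|β j| - |b j|) := by
    rcases hV with h | h
    · rw [h, abs_zero, sub_zero, sub_zero]
      have := mul_nonneg hv0 (abs_nonneg (β j))
      have := mul_nonneg hV0 (abs_nonneg (β j))
      linarith
    · have htri : -|β j - b j| ≤ |β j| - |b j| := by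
        have := abs_sub_abs_le_abs_sub (b j) (β j)
        rw [abs_sub_comm] at this
        linarith
      have := mul_le_mul_of_nonneg_left htri hv0
      have := mul_le_mul_of_nonneg_right h (abs_nonneg (β j - b j))
      linarith
  have h2 : -(W * |β j - b j|) ≤ |init j| ^ γ₂ * (|β j - init j| - |b j - init j|) := by
    have htri : -|β j - b j| ≤ |β j - init j| - |b j - init j| := by
      have := abs_sub_abs_le_abs_sub (b j - init j) (β j - init j)
      rw [sub_sub_sub_cancel_right, abs_sub_comm (b j) (β j)] at this
      linarith
    have := mul_le_mul_of_nonneg_left htri (Real.rpow_nonneg (abs_nonneg (init j)) γ₂)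
    have := mul_le_mul_of_nonneg_right hW (abs_nonneg (β j - b j))
    linarith
  have h3 := mul_le_mul_of_nonneg_left h1 hlam
  have h4 := mul_le_mul_of_nonneg_left h2 heta
  rw [penaltyIncrement]
  linarith

lemma abs_mulVec_le (A : Matrix (Fin p) (Fin p) ℝ) {a D : ℝ} (ha : ∀ j k, |A j k| ≤ a)
    {d : Fin p → ℝ} (hd : ∀ k, |d k| ≤ D) (j : Fin p) : |(A *ᵥ d) j| ≤ p * (a * D) := by
  change |∑ k, A j k * d k| ≤ _
  refine (Finset.abs_sum_le_sum_abs _ _).trans ?_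
  calc ∑ k, |A j k * d k| ≤ ∑ _k : Fin p, a * D := by
        refine Finset.sum_le_sum fun k _ => ?_
        rw [abs_mul]
        exact mul_le_mul (ha j k) (hd k) (abs_nonneg _) ((abs_nonneg _).trans (ha j k))
    _ = p * (a * D) := by simp

/-- Rate of convergence of the estimator, from the comparison with the true coefficients. -/
lemma norm_sub_le (hγ₁ : 0 ≤ γ₁) (hγ₂ : 0 ≤ γ₂) (hlam : 0 < lam) (heta : 0 ≤ eta) (hn : 0 < n)
    {βstar : Fin p → ℝ} {e : Fin n → ℝ}
    (hβ : IsEstimate X (X *ᵥ βstar + e) lam eta γ₁ γ₂ init β)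
    (hb : ∀ j, |init j| ^ γ₁ = 0 → βstar j = 0)
    {c : ℝ} (hc : 0 < c) (hquad : ∀ u, c * ‖u‖ ^ 2 ≤ u ⬝ᵥ ((Xᵀ * X) *ᵥ u))
    {G V W : ℝ} (hG : ∀ j, |(Xᵀ *ᵥ e) j| ≤ G)
    (hV0 : 0 ≤ V) (hV : ∀ j, βstar j = 0 ∨ (|init j| ^ γ₁)⁻¹ ≤ V)
    (hW : ∀ j, |init j| ^ γ₂ ≤ W) :
    ‖β - βstar‖ ≤ p * (2 * G + lam * V + eta * W) / c := by
  rcases eq_or_ne β βstar with h | hne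
  -- The signs of `G` and `W` are read off from a coordinate, so `p = 0` is separate.
  · rcases Nat.eq_zero_or_pos p with hp | hp
    · subst hp; simp [h]
    · have hG0 := (abs_nonneg _).trans (hG ⟨0, hp⟩)
      have hW0 := (Real.rpow_nonneg (abs_nonneg _) _).trans (hW ⟨0, hp⟩)
      rw [h, sub_self, norm_zero]
      positivity
  have hupos : 0 < ‖β - βstar‖ := norm_pos_iff.2 (sub_ne_zero.2 hne)
  have key := basic_inequality hγ₁ hγ₂ hlam heta hn hβ hb
  rw [sub_self, Matrix.mulVec_zero, sub_zero] at key
  have hq := hquad (β - βstar)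
  have hcoord : ∀ j, |β j - βstar j| ≤ ‖β - βstar‖ := fun j => norm_le_pi_norm (β - βstar) j
  have hcross : (β - βstar) ⬝ᵥ (Xᵀ *ᵥ e) ≤ ∑ j, G * |β j - βstar j| := by
    refine Finset.sum_le_sum fun j _ => (le_abs_self _).trans ?_
    rw [abs_mul, mul_comm]
    exact mul_le_mul_of_nonneg_right (hG j) (abs_nonneg _)
  have hpen := Finset.sum_le_sum fun j (_ : j ∈ Finset.univ) =>
    neg_le_penaltyIncrement (β := β) hlam.le heta hV0 (hV j) (hW j)
  rw [Finset.sum_neg_distrib, ← Finset.mul_sum] at hpen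
  rw [← Finset.mul_sum] at hcross
  have hsum : (2 * G + lam * V + eta * W) * ∑ j, |β j - βstar j|
      ≤ (p * (2 * G + lam * V + eta * W)) * ‖β - βstar‖ := by
    rw [Finset.mul_sum]
    calc _ ≤ ∑ _j : Fin p, (2 * G + lam * V + eta * W) * ‖β - βstar‖ := by
          refine Finset.sum_le_sum fun j _ => mul_le_mul_of_nonneg_left (hcoord j) ?_
          have hG0 := (abs_nonneg _).trans (hG j)
          have hW0 := (Real.rpow_nonneg (abs_nonneg _) _).trans (hW j)
          positivity
      _ = _ := by simp; ring
  rw [le_div_iff₀ hc]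
  refine le_of_mul_le_mul_right ?_ hupos
  nlinarith

end Deterministic

/-! ### Consequences of the growth conditions -/

section Regimes

variable {m : ℕ → ℕ} {lam eta : ℕ → ℝ} {γ₁ γ₂ : ℝ}

lemma sqrt_rpow_eq {x : ℝ} (hx : 0 ≤ x) (γ : ℝ) : √(x ^ γ) = √x ^ γ := by
  rw [Real.sqrt_eq_rpow, Real.sqrt_eq_rpow, ← Real.rpow_mul hx, ← Real.rpow_mul hx, mul_comm]

lemma eventually_mul_sqrt_le
    (h : Tendsto (fun n : ℕ => √((m n : ℝ) ^ γ₁ / n) * lam n) atTop atTop) (B : ℝ) :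
    ∀ᶠ n : ℕ in atTop, B * √(n : ℝ) ≤ lam n * √(m n : ℝ) ^ γ₁ := by
  filter_upwards [h.eventually_ge_atTop B, eventually_gt_atTop 0] with n hB hn
  have hn' : 0 < √(n : ℝ) := Real.sqrt_pos.2 (by exact_mod_cast hn)
  rw [Real.sqrt_div (by positivity), sqrt_rpow_eq (by positivity), div_mul_eq_mul_div,
    le_div_iff₀ hn', mul_comm _ (lam n)] at hB
  exact hB

/-- Strict positivity of `λ` is essential: for `λ = 0` the convention `0 * ∞ = 0` removes the
constraint carried by infinite weights. -/
lemma pos_of_sqrt_le {n : ℕ} {l x : ℝ} (hl : 0 ≤ l) (hn : 0 < n) (h : √(n : ℝ) ≤ l * x) :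
    0 < l := by
  have hn' : 0 < √(n : ℝ) := Real.sqrt_pos.2 (by exact_mod_cast hn)
  refine lt_of_le_of_ne hl fun h0 => ?_
  rw [← h0, zero_mul] at h
  linarith

lemma RootMRegime.eventually_le (h : RootMRegime m lam eta γ₁ γ₂) (hlam : ∀ n, 0 ≤ lam n)
    (hm : ∀ᶠ n in atTop, 0 < m n) {B : ℝ} (hB : 0 < B) :
    ∀ᶠ n : ℕ in atTop,
      B * (√(n : ℝ) + eta n / √(m n : ℝ) ^ γ₂) ≤ lam n * √(m n : ℝ) ^ γ₁ := by
  -- Each of the two summands is allotted half of the right-hand side.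
  have hδ : (0 : ℝ) < 1 / (2 * B) := by positivity
  filter_upwards [eventually_mul_sqrt_le h.1 (2 * B), eventually_mul_sqrt_le h.1 1,
    h.2.2.2.eventually_le_const hδ, hm, eventually_gt_atTop 0] with n h1 h2 h3 hmn hn
  have hl : 0 < lam n := pos_of_sqrt_le (hlam n) hn (by simpa using h2)
  have hs : 0 < √(m n : ℝ) := Real.sqrt_pos.2 (by exact_mod_cast hmn)
  have hs2 : 0 < √(m n : ℝ) ^ γ₂ := by positivity
  rw [sqrt_rpow_eq (by positivity), Real.rpow_add hs, div_le_iff₀ (by positivity)] at h3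
  have h4 : eta n / √(m n : ℝ) ^ γ₂ ≤ 1 / (2 * B) * (lam n * √(m n : ℝ) ^ γ₁) := by
    rw [div_le_iff₀ hs2]
    linarith
  have h5 : B * (1 / (2 * B) * (lam n * √(m n : ℝ) ^ γ₁)) = lam n * √(m n : ℝ) ^ γ₁ / 2 := by
    field_simp
  have h6 := mul_le_mul_of_nonneg_left h4 hB.le
  linarith

lemma RootMRegime.eventually_eta_ge (h : RootMRegime m lam eta γ₁ γ₂) (hlam : ∀ n, 0 ≤ lam n)
    (B V : ℝ) {W : ℝ} (hW : 0 < W) :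
    ∀ᶠ n : ℕ in atTop, B * √(n : ℝ) + lam n * V ≤ eta n * W := by
  filter_upwards [eventually_mul_sqrt_le h.1 1, h.2.1.eventually_ge_atTop (2 * B / W),
    h.2.2.1.eventually_ge_atTop (2 * V / W), eventually_gt_atTop 0] with n h1 h2 h3 hn
  have hl : 0 < lam n := pos_of_sqrt_le (hlam n) hn (by simpa using h1)
  have hn' : 0 < √(n : ℝ) := Real.sqrt_pos.2 (by exact_mod_cast hn)
  rw [div_le_div_iff₀ hW (by assumption)] at h2 h3
  linarith

/-- The penalty on the inactive coefficients dominates `√n + λ_n + η_n`, which is `o(n)`. -/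
def Dominated (m : ℕ → ℕ) (lam eta : ℕ → ℝ) (γ₁ : ℝ) : Prop :=
  (∀ B : ℝ, 0 < B → ∀ᶠ n : ℕ in atTop,
    B * (√(n : ℝ) + lam n + eta n) ≤ lam n * √(m n : ℝ) ^ γ₁) ∧
  Tendsto (fun n : ℕ => (√(n : ℝ) + lam n + eta n) / n) atTop (𝓝 0)

lemma tendsto_inv_sqrt_nat : Tendsto (fun n : ℕ => (√(n : ℝ))⁻¹) atTop (𝓝 0) :=
  tendsto_inv_atTop_zero.comp (Real.tendsto_sqrt_atTop.comp tendsto_natCast_atTop_atTop)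

/-- Here `√n + λ + η` is `O(√n)`. -/
lemma RootNRegime.dominated (h : RootNRegime m lam eta γ₁) :
    Dominated m lam eta γ₁ := by
  obtain ⟨h1, ⟨l, hl0, hl⟩, ⟨e, he0, he⟩⟩ := h
  refine ⟨fun B hB => ?_, ?_⟩
  · filter_upwards [eventually_mul_sqrt_le h1 (B * (1 + (l + 1) + (e + 1))),
      hl.eventually_le_const (lt_add_one l), he.eventually_le_const (lt_add_one e),
      eventually_gt_atTop 0] with n h2 h3 h4 hn
    have hn' : 0 < √(n : ℝ) := Real.sqrt_pos.2 (by exact_mod_cast hn)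
    rw [div_le_iff₀ hn'] at h3 h4
    refine le_trans ?_ h2
    rw [mul_assoc]
    exact mul_le_mul_of_nonneg_left (by linarith) hB.le
  · have h2 := tendsto_inv_sqrt_nat.mul ((hl.const_add 1).add he)
    rw [zero_mul] at h2
    refine h2.congr' ?_
    filter_upwards [eventually_gt_atTop 0] with n hn
    have hn' : 0 < √(n : ℝ) := Real.sqrt_pos.2 (by exact_mod_cast hn)
    have hsq : √(n : ℝ) * √(n : ℝ) = n := Real.mul_self_sqrt (by positivity)
    rw [← hsq, Real.sqrt_mul_self hn'.le]
    field_simp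

/-- Here `λ` dominates the sum, and the extra factor `m^(γ₁/2)` diverges because `γ₁ > 0`. -/
lemma SubRootNRegime.dominated (h : SubRootNRegime lam eta) (hγ₁ : 0 < γ₁)
    (hlam : ∀ n, 0 ≤ lam n) (heta : ∀ n, 0 ≤ eta n)
    (hs : Tendsto (fun n => √(m n : ℝ)) atTop atTop) : Dominated m lam eta γ₁ := by
  obtain ⟨h1, h2, h3⟩ := h
  have hle : ∀ᶠ n : ℕ in atTop, √(n : ℝ) + lam n + eta n ≤ 3 * lam n := by
    filter_upwards [h1.eventually_ge_atTop 1, h3.eventually_le_const one_pos,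
      eventually_gt_atTop 0] with n h4 h5 hn
    have hn' : 0 < √(n : ℝ) := Real.sqrt_pos.2 (by exact_mod_cast hn)
    rw [le_div_iff₀ hn', one_mul] at h4
    rw [div_le_iff₀ (hn'.trans_le h4)] at h5
    linarith
  refine ⟨fun B hB => ?_, ?_⟩
  · filter_upwards [hle, ((tendsto_rpow_atTop hγ₁).comp hs).eventually_ge_atTop (B * 3)]
      with n h4 h5
    have h6 := mul_le_mul_of_nonneg_left h4 hB.le
    have h7 := mul_le_mul_of_nonneg_left h5 (hlam n)
    simp only [Function.comp_apply] at h7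
    linarith
  · refine squeeze_zero' (g := fun n : ℕ => 3 * (lam n / n)) ?_ ?_ (by simpa using h2.const_mul 3)
    · filter_upwards with n
      have := hlam n
      have := heta n
      positivity
    · filter_upwards [hle] with n h4
      rw [← mul_div_assoc]
      exact div_le_div_of_nonneg_right h4 (by positivity)

lemma eventually_natCast_le {r₀ : ℝ} (hm : ∀ᶠ n in atTop, 0 < m n)
    (hnm : Tendsto (fun n : ℕ => (n : ℝ) / (m n : ℝ)) atTop (𝓝 r₀)) :
    ∀ᶠ n : ℕ in atTop, √(n : ℝ) ≤ √(r₀ + 1) * √(m n : ℝ) := by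
  filter_upwards [hm, hnm.eventually_le_const (lt_add_one r₀)] with n hmn h
  have hmn' : (0 : ℝ) < m n := by exact_mod_cast hmn
  rw [div_le_iff₀ hmn'] at h
  rw [← Real.sqrt_mul' _ hmn'.le]
  exact Real.sqrt_le_sqrt h

lemma tendsto_sqrt_source {r₀ : ℝ} (hr₀ : 0 ≤ r₀) (hm : ∀ᶠ n in atTop, 0 < m n)
    (hnm : Tendsto (fun n : ℕ => (n : ℝ) / (m n : ℝ)) atTop (𝓝 r₀)) :
    Tendsto (fun n => √(m n : ℝ)) atTop atTop := by
  have hR : 0 < √(r₀ + 1) := Real.sqrt_pos.2 (by linarith)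
  refine tendsto_atTop_mono' atTop ?_
    ((Real.tendsto_sqrt_atTop.comp tendsto_natCast_atTop_atTop).atTop_div_const hR)
  filter_upwards [eventually_natCast_le hm hnm] with n h
  rw [Function.comp_apply, div_le_iff₀ hR]
  linarith

end Regimes

/-! ### Bounds on the Gram matrix -/

section Gram

variable {p : ℕ}

/-- Minimise over the compact unit sphere and rescale; the sphere is empty when `p = 0`. -/
lemma exists_quadraticForm_ge {C : Matrix (Fin p) (Fin p) ℝ} (hC : C.PosDef) :
    ∃ c : ℝ, 0 < c ∧ ∀ u : Fin p → ℝ, c * ‖u‖ ^ 2 ≤ u ⬝ᵥ (C *ᵥ u) := by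
  rcases (Metric.sphere (0 : Fin p → ℝ) 1).eq_empty_or_nonempty with he | hne
  · refine ⟨1, one_pos, fun u => ?_⟩
    have hu : u = 0 := by
      by_contra hu
      have : ‖u‖⁻¹ • u ∈ Metric.sphere (0 : Fin p → ℝ) 1 := by
        simp [norm_smul, inv_mul_cancel₀ (norm_ne_zero_iff.2 hu)]
      rw [he] at this
      exact this
    simp [hu]
  · have hcont : Continuous fun u : Fin p → ℝ => u ⬝ᵥ (C *ᵥ u) :=
      continuous_id.dotProduct (continuous_const.matrix_mulVec continuous_id)
    obtain ⟨v, hv, hmin⟩ := (isCompact_sphere (0 : Fin p → ℝ) 1).exists_isMinOn hne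
      hcont.continuousOn
    have hv0 : v ≠ 0 := by
      rintro rfl
      simp at hv
    refine ⟨v ⬝ᵥ (C *ᵥ v), by simpa using hC.dotProduct_mulVec_pos hv0, fun u => ?_⟩
    rcases eq_or_ne u 0 with rfl | hu
    · simp
    have hun : 0 < ‖u‖ := norm_pos_iff.2 hu
    have hmem : ‖u‖⁻¹ • u ∈ Metric.sphere (0 : Fin p → ℝ) 1 := by
      simp [norm_smul, inv_mul_cancel₀ hun.ne']
    have h := hmin hmem
    simp only [Set.mem_ofPred_eq, Matrix.mulVec_smul, dotProduct_smul, smul_dotProduct,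
      smul_eq_mul] at h
    rw [← mul_assoc, ← mul_inv, inv_mul_eq_div, le_div_iff₀ (by positivity)] at h
    rwa [sq]

lemma abs_quadraticForm_le (D : Matrix (Fin p) (Fin p) ℝ) (u : Fin p → ℝ) :
    |u ⬝ᵥ (D *ᵥ u)| ≤ (∑ j, ∑ k, |D j k|) * ‖u‖ ^ 2 := by
  have hu : ∀ j, |u j| ≤ ‖u‖ := fun j => norm_le_pi_norm u j
  rw [dotProduct, Finset.sum_mul]
  refine (Finset.abs_sum_le_sum_abs _ _).trans (Finset.sum_le_sum fun j _ => ?_)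
  rw [abs_mul, Finset.sum_mul, Matrix.mulVec, dotProduct]
  calc |u j| * |∑ k, D j k * u k| ≤ ‖u‖ * ∑ k, |D j k| * ‖u‖ := by
        refine mul_le_mul (hu j) ?_ (abs_nonneg _) (norm_nonneg _)
        refine (Finset.abs_sum_le_sum_abs _ _).trans (Finset.sum_le_sum fun k _ => ?_)
        rw [abs_mul]
        exact mul_le_mul_of_nonneg_left (hu k) (abs_nonneg _)
    _ = _ := by
        rw [Finset.mul_sum]
        exact Finset.sum_congr rfl fun k _ => by ring

variable {X : (n : ℕ) → Matrix (Fin n) (Fin p) ℝ} {C : Matrix (Fin p) (Fin p) ℝ}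

lemma eventually_abs_gram_le
    (hXC : Tendsto (fun n : ℕ => (1 / (n : ℝ)) • ((X n)ᵀ * X n)) atTop (𝓝 C)) :
    ∃ a : ℝ, 0 ≤ a ∧ ∀ᶠ n : ℕ in atTop, ∀ j k, |((X n)ᵀ * X n) j k| ≤ a * n := by
  refine ⟨∑ j, ∑ k, |C j k| + 1, by positivity, ?_⟩
  refine eventually_all.2 fun j => eventually_all.2 fun k => ?_
  have h1 : Tendsto (fun n : ℕ => |((1 / (n : ℝ)) • ((X n)ᵀ * X n)) j k|) atTop (𝓝 |C j k|) :=
    ((hXC.apply_nhds j).apply_nhds k).abs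
  have h2 : |C j k| ≤ ∑ j, ∑ k, |C j k| :=
    (Finset.single_le_sum (f := fun k => |C j k|) (fun _ _ => abs_nonneg _)
      (Finset.mem_univ k)).trans
    (Finset.single_le_sum (f := fun j => ∑ k, |C j k|)
      (fun _ _ => Finset.sum_nonneg fun _ _ => abs_nonneg _) (Finset.mem_univ j))
  filter_upwards [h1.eventually_le_const (lt_of_le_of_lt h2 (lt_add_one _)),
    eventually_gt_atTop 0] with n hn hpos
  have hpos' : (0 : ℝ) < n := by exact_mod_cast hpos
  rwa [Matrix.smul_apply, smul_eq_mul, abs_mul, abs_of_pos (by positivity), one_div,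
    inv_mul_le_iff₀ hpos', mul_comm] at hn

lemma eventually_gram_quadraticForm_ge (hC : C.PosDef)
    (hXC : Tendsto (fun n : ℕ => (1 / (n : ℝ)) • ((X n)ᵀ * X n)) atTop (𝓝 C)) :
    ∃ c : ℝ, 0 < c ∧ ∀ᶠ n : ℕ in atTop, ∀ u : Fin p → ℝ,
      (c * n) * ‖u‖ ^ 2 ≤ u ⬝ᵥ (((X n)ᵀ * X n) *ᵥ u) := by
  obtain ⟨c, hc, hquad⟩ := exists_quadraticForm_ge hC
  -- The other half of `c` absorbs the deviation of the scaled Gram matrix from `C`.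
  refine ⟨c / 2, by positivity, ?_⟩
  have h1 : Tendsto (fun n : ℕ => ∑ j, ∑ k, |((1 / (n : ℝ)) • ((X n)ᵀ * X n) - C) j k|) atTop
      (𝓝 0) := by
    have : Tendsto (fun n : ℕ => ∑ j, ∑ k, |((1 / (n : ℝ)) • ((X n)ᵀ * X n) - C) j k|) atTop
        (𝓝 (∑ j, ∑ k, |(C - C) j k|)) :=
      tendsto_finsetSum _ fun j _ => tendsto_finsetSum _ fun k _ =>
        (((hXC.sub_const C).apply_nhds j).apply_nhds k).abs
    simpa using this
  filter_upwards [h1.eventually_le_const (half_pos hc), eventually_gt_atTop 0] with n hn hpos u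
  have hpos' : (0 : ℝ) < n := by exact_mod_cast hpos
  have h2 := (abs_le.1 (abs_quadraticForm_le ((1 / (n : ℝ)) • ((X n)ᵀ * X n) - C) u)).1
  have h3 := mul_le_mul_of_nonneg_right hn (sq_nonneg ‖u‖)
  have h4 := hquad u
  rw [Matrix.sub_mulVec, dotProduct_sub, Matrix.smul_mulVec, dotProduct_smul, smul_eq_mul] at h2
  have h5 : c / 2 * ‖u‖ ^ 2 ≤ 1 / (n : ℝ) * (u ⬝ᵥ (((X n)ᵀ * X n) *ᵥ u)) := by linarith
  rw [one_div, ← div_eq_inv_mul, le_div_iff₀ hpos'] at h5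
  linarith

end Gram

/-! ### Deterministic support recovery -/

section Selection

variable {p : ℕ} {βstar : Fin p → ℝ} {X : (n : ℕ) → Matrix (Fin n) (Fin p) ℝ} {m : ℕ → ℕ}
  {lam eta : ℕ → ℝ} {γ₁ γ₂ : ℝ}

/-- For the source estimates `init` with `‖init - β*‖ ≤ K / √m` and the noise vectors `e` with
`‖Xᵀ e‖ ≤ K √n`, in the supremum norm, every estimate recovers the support. -/
def SelectsWithin (X : (n : ℕ) → Matrix (Fin n) (Fin p) ℝ) (βstar : Fin p → ℝ) (m : ℕ → ℕ)
    (lam eta : ℕ → ℝ) (γ₁ γ₂ : ℝ) (K : ℝ) (n : ℕ) : Prop :=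
  ∀ (init : Fin p → ℝ) (e : Fin n → ℝ) (β : Fin p → ℝ),
    (∀ j, |init j - βstar j| ≤ K / √(m n : ℝ)) → (∀ j, |((X n)ᵀ *ᵥ e) j| ≤ K * √(n : ℝ)) →
    IsEstimate (X n) (X n *ᵥ βstar + e) (lam n) (eta n) γ₁ γ₂ init β →
    Function.support β = Function.support βstar

lemma eventually_half_le_abs_init (hs : Tendsto (fun n => √(m n : ℝ)) atTop atTop) (K : ℝ) :
    ∀ᶠ n in atTop, ∀ init : Fin p → ℝ, (∀ j, |init j - βstar j| ≤ K / √(m n : ℝ)) →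
      ∀ j, |βstar j| / 2 ≤ |init j| := by
  have h : ∀ᶠ n in atTop, ∀ j, βstar j ≠ 0 → K / √(m n : ℝ) ≤ |βstar j| / 2 := by
    refine eventually_all.2 fun j => ?_
    by_cases hj : βstar j = 0
    · simp [hj]
    filter_upwards [(hs.const_div_atTop K).eventually_le_const (half_pos (abs_pos.2 hj))]
      with n hn _ using hn
  filter_upwards [h] with n hn init hinit j
  by_cases hj : βstar j = 0
  · simp [hj]
  have h1 := (hinit j).trans (hn j hj)
  have h2 := abs_sub_abs_le_abs_sub (βstar j) (init j)
  rw [abs_sub_comm] at h2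
  linarith

lemma abs_score_le {n : ℕ} {e : Fin n → ℝ} {K a D : ℝ} {b : Fin p → ℝ}
    (ha : ∀ j k, |((X n)ᵀ * X n) j k| ≤ a) (he : ∀ j, |((X n)ᵀ *ᵥ e) j| ≤ K)
    (hb : ∀ j, |(b - βstar) j| ≤ D) (j : Fin p) :
    |((X n)ᵀ *ᵥ e - ((X n)ᵀ * X n) *ᵥ (b - βstar)) j| ≤ K + p * (a * D) := by
  rw [Pi.sub_apply]
  exact (abs_sub _ _).trans (add_le_add (he j) (abs_mulVec_le _ ha hb j))

lemma RootMRegime.eventually_selectsWithin (h : RootMRegime m lam eta γ₁ γ₂)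
    (hγ₁ : 0 ≤ γ₁) (hγ₂ : 0 ≤ γ₂) (hlam : ∀ n, 0 ≤ lam n) (heta : ∀ n, 0 ≤ eta n)
    (hm : ∀ᶠ n in atTop, 0 < m n) (hs : Tendsto (fun n => √(m n : ℝ)) atTop atTop)
    {ρ : ℝ} (hns : ∀ᶠ n : ℕ in atTop, √(n : ℝ) ≤ ρ * √(m n : ℝ)) {a : ℝ} (ha0 : 0 ≤ a)
    (ha : ∀ᶠ n : ℕ in atTop, ∀ j k, |((X n)ᵀ * X n) j k| ≤ a * n) {K : ℝ} (hK : 0 < K)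
    (hρ : 0 ≤ ρ) :
    ∀ᶠ n in atTop, SelectsWithin X βstar m lam eta γ₁ γ₂ K n := by
  -- The score at `b` is at most `K √n + p (a n)(K / √m)`, and `n / √m ≤ ρ √n`, giving `R √n`.
  set R := K + p * (a * (K * ρ)) with hR
  have hR0 : 0 ≤ R := by positivity
  have hon : ∀ᶠ n : ℕ in atTop, ∀ j, βstar j ≠ 0 → (2 * R + 1) * √(n : ℝ)
      + lam n * ((|βstar j| / 2) ^ γ₁)⁻¹ ≤ eta n * (|βstar j| / 2) ^ γ₂ := by
    refine eventually_all.2 fun j => ?_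
    by_cases hj : βstar j = 0
    · simp [hj]
    have hpos := abs_pos.2 hj
    filter_upwards [h.eventually_eta_ge hlam (2 * R + 1) ((|βstar j| / 2) ^ γ₁)⁻¹
      (show 0 < (|βstar j| / 2) ^ γ₂ by positivity)] with n hn _ using hn
  have hB : 0 < K ^ γ₁ * (2 * R + 1 + K ^ γ₂) := by positivity
  filter_upwards [hon, h.eventually_le hlam hm hB, h.eventually_le hlam hm one_pos, hm, hns, ha,
    eventually_half_le_abs_init (βstar := βstar) hs K, eventually_gt_atTop 0]
    with n hon hoff hlam1 hmn hns ha hhalf hn init e β hinit he hβ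
  have hspos : 0 < √(m n : ℝ) := Real.sqrt_pos.2 (by exact_mod_cast hmn)
  have hs2 : 0 ≤ eta n / √(m n : ℝ) ^ γ₂ := div_nonneg (heta n) (by positivity)
  have hn1 : 1 ≤ √(n : ℝ) := Real.one_le_sqrt.2 (by exact_mod_cast hn)
  have hl : 0 < lam n := pos_of_sqrt_le (hlam n) hn (x := √(m n : ℝ) ^ γ₁) (by linarith)
  have hhalf' := hhalf init hinit
  have hinit0 : ∀ j, βstar j ≠ 0 → 0 < |init j| := fun j hj => by
    have := abs_pos.2 hj
    have := hhalf' j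
    linarith
  let b : Fin p → ℝ := fun j => if βstar j = 0 then 0 else init j
  have hb0 : ∀ j, βstar j = 0 → b j = 0 := fun j hj => by simp [b, hj]
  have hb1 : ∀ j, βstar j ≠ 0 → b j = init j := fun j hj => by simp [b, hj]
  have hβz := fun (b : Fin p → ℝ) hb => (hβ.eq_zero_and_realObjective_le (b := b)
    hγ₁ hγ₂ hl (heta n) hn hb).1
  have hadm : ∀ j, |init j| ^ γ₁ = 0 → b j = 0 := fun j hj => by
    by_contra hne
    have hj0 : βstar j ≠ 0 := fun h0 => hne (hb0 j h0)
    exact (Real.rpow_pos_of_pos (hinit0 j hj0) γ₁).ne' hj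
  have hbd : ∀ j, |(b - βstar) j| ≤ K / √(m n : ℝ) := fun j => by
    by_cases hj : βstar j = 0
    · rw [Pi.sub_apply, hb0 j hj, hj, sub_zero, abs_zero]
      positivity
    · rw [Pi.sub_apply, hb1 j hj]
      exact hinit j
  have hscore : ∀ j, |((X n)ᵀ *ᵥ e - ((X n)ᵀ * X n) *ᵥ (b - βstar)) j| ≤ R * √(n : ℝ) :=
    fun j => by
      refine (abs_score_le ha he hbd j).trans ?_
      have h1 : (n : ℝ) * (K / √(m n : ℝ)) ≤ K * ρ * √(n : ℝ) := by
        rw [← mul_div_assoc, div_le_iff₀ hspos]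
        calc (n : ℝ) * K = K * √(n : ℝ) * √(n : ℝ) := by
              rw [mul_assoc, Real.mul_self_sqrt (by positivity), mul_comm]
          _ ≤ K * √(n : ℝ) * (ρ * √(m n : ℝ)) := by gcongr
          _ = _ := by ring
      have h2 : (p : ℝ) * (a * n * (K / √(m n : ℝ))) ≤ p * (a * (K * ρ * √(n : ℝ))) := by
        rw [mul_assoc a]
        gcongr
      rw [hR]
      linarith
  have hβb : β = b := by
    refine eq_of_penaltyIncrement_ge hγ₁ hγ₂ hl (heta n) hn hβ hadm hscore fun j => ?_
    have hR1 : 2 * (R * √(n : ℝ)) + 1 ≤ (2 * R + 1) * √(n : ℝ) := by linarith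
    by_cases hj : βstar j = 0
    · refine penaltyIncrement_ge_of_init_small hγ₁ hγ₂ hl.le (heta n) hK hspos
        (by simpa [hj] using hinit j) (hβz b hadm j) (hb0 j hj) (le_trans ?_ hoff)
      rw [mul_assoc]
      refine mul_le_mul_of_nonneg_left ?_ (by positivity)
      have : 0 ≤ (2 * R + 1) * (eta n / √(m n : ℝ) ^ γ₂) := by positivity
      have : 0 ≤ K ^ γ₂ * √(n : ℝ) := by positivity
      linarith
    · have hpos : 0 < |βstar j| / 2 := half_pos (abs_pos.2 hj)
      exact penaltyIncrement_ge_of_eq_init hl.le (heta n) (hb1 j hj)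
        (inv_anti₀ (by positivity) (Real.rpow_le_rpow hpos.le (hhalf' j) hγ₁))
        (Real.rpow_le_rpow hpos.le (hhalf' j) hγ₂)
        ((add_le_add_left hR1 _).trans (hon j hj))
  ext j
  rw [Function.mem_support, Function.mem_support, hβb]
  refine ⟨fun hne h0 => hne (hb0 j h0), fun hj => ?_⟩
  rw [hb1 j hj]
  exact abs_pos.1 (hinit0 j hj)

lemma Dominated.eventually_selectsWithin (h : Dominated m lam eta γ₁)
    (hγ₁ : 0 ≤ γ₁) (hγ₂ : 0 ≤ γ₂) (hlam : ∀ n, 0 ≤ lam n) (heta : ∀ n, 0 ≤ eta n)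
    (hs : Tendsto (fun n => √(m n : ℝ)) atTop atTop)
    {a : ℝ} (ha0 : 0 ≤ a)
    (ha : ∀ᶠ n : ℕ in atTop, ∀ j k, |((X n)ᵀ * X n) j k| ≤ a * n)
    {c : ℝ} (hc : 0 < c) (hquad : ∀ᶠ n : ℕ in atTop, ∀ u : Fin p → ℝ,
      (c * n) * ‖u‖ ^ 2 ≤ u ⬝ᵥ (((X n)ᵀ * X n) *ᵥ u)) {K : ℝ} (hK : 0 < K) :
    ∀ᶠ n in atTop, SelectsWithin X βstar m lam eta γ₁ γ₂ K n := by
  set V := ∑ j, ((|βstar j| / 2) ^ γ₁)⁻¹ with hV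
  have hV0 : 0 ≤ V := by positivity
  set W := (‖βstar‖ + K) ^ γ₂ with hW
  have hW0 : 0 ≤ W := by positivity
  -- `Q` is the constant of the rate from `norm_sub_le`; `R` below then bounds the score at `b` in
  -- units of `√n + λ + η`.
  set Q := p * (2 * K + V + W) / c with hQ
  have hQ0 : 0 ≤ Q := by positivity
  set R := K + p * (a * Q) with hR
  have hR0 : 0 ≤ R := by positivity
  have hcons : ∀ᶠ n : ℕ in atTop, ∀ j, βstar j ≠ 0 →
      Q * ((√(n : ℝ) + lam n + eta n) / n) < |βstar j| := by
    refine eventually_all.2 fun j => ?_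
    by_cases hj : βstar j = 0
    · simp [hj]
    have h1 := h.2.const_mul Q
    rw [mul_zero] at h1
    filter_upwards [h1.eventually_lt_const (abs_pos.2 hj)] with n hn _ using hn
  have hB : 0 < K ^ γ₁ * (2 * R + 1 + K ^ γ₂) := by positivity
  filter_upwards [hcons, h.1 _ hB, h.1 1 one_pos, ha, hquad, hs.eventually_ge_atTop 1,
    eventually_half_le_abs_init (βstar := βstar) hs K, eventually_gt_atTop 0]
    with n hcons hoff hlam1 ha hquad hs1 hhalf hn init e β hinit he hβ
  have hn' : (0 : ℝ) < n := by exact_mod_cast hn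
  have hspos : 0 < √(m n : ℝ) := one_pos.trans_le hs1
  have heta0 := heta n
  have hlam0 := hlam n
  have hn1 : 1 ≤ √(n : ℝ) := Real.one_le_sqrt.2 (by exact_mod_cast hn)
  have hl : 0 < lam n := pos_of_sqrt_le (hlam n) hn (x := √(m n : ℝ) ^ γ₁) (by linarith)
  set ρ := √(n : ℝ) + lam n + eta n with hρ
  have hρ0 : 0 ≤ ρ := by positivity
  have hhalf' := hhalf init hinit
  have hinit0 : ∀ j, βstar j ≠ 0 → 0 < |init j| := fun j hj => by
    have := abs_pos.2 hj
    have := hhalf' j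
    linarith
  have hadm0 : ∀ j, |init j| ^ γ₁ = 0 → βstar j = 0 := fun j hj => by
    by_contra hj0
    exact (Real.rpow_pos_of_pos (hinit0 j hj0) γ₁).ne' hj
  have hrate : ‖β - βstar‖ ≤ Q * (ρ / n) := by
    refine (norm_sub_le hγ₁ hγ₂ hl heta0 hn hβ hadm0 (by positivity) hquad he hV0
      (fun j => ?_) (fun j => ?_) (W := W)).trans ?_
    · rcases eq_or_ne (βstar j) 0 with hj | hj
      · exact Or.inl hj
      have hpos : 0 < |βstar j| / 2 := half_pos (abs_pos.2 hj)
      exact Or.inr ((inv_anti₀ (by positivity)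
        (Real.rpow_le_rpow hpos.le (hhalf' j) hγ₁)).trans
        (Finset.single_le_sum (f := fun j => ((|βstar j| / 2) ^ γ₁)⁻¹)
          (fun _ _ => by positivity) (Finset.mem_univ j)))
    · refine Real.rpow_le_rpow (abs_nonneg _) ?_ hγ₂
      have h1 := (hinit j).trans (div_le_self hK.le hs1)
      have h2 := abs_sub_abs_le_abs_sub (init j) (βstar j)
      have h3 : |βstar j| ≤ ‖βstar‖ := norm_le_pi_norm βstar j
      linarith
    · have h1 : 2 * (K * √(n : ℝ)) + lam n * V + eta n * W ≤ (2 * K + V + W) * ρ := by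
        have : 0 ≤ (2 * K) * (lam n + eta n) := by positivity
        have : 0 ≤ V * (√(n : ℝ) + eta n) := by positivity
        have : 0 ≤ W * (√(n : ℝ) + lam n) := by positivity
        rw [hρ]
        linarith
      calc _ ≤ p * ((2 * K + V + W) * ρ) / (c * n) := by gcongr
        _ = Q * (ρ / n) := by rw [hQ]; field_simp
  have hcoord : ∀ j, |β j - βstar j| ≤ Q * (ρ / n) :=
    fun j => (norm_le_pi_norm (β - βstar) j).trans hrate
  -- This `b` depends on the minimiser and agrees with it on the support, so only coordinates off
  -- the support need a penalty bound.
  let b : Fin p → ℝ := fun j => if βstar j = 0 then 0 else β j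
  have hb0 : ∀ j, βstar j = 0 → b j = 0 := fun j hj => by simp [b, hj]
  have hb1 : ∀ j, βstar j ≠ 0 → b j = β j := fun j hj => by simp [b, hj]
  have hadm : ∀ j, |init j| ^ γ₁ = 0 → b j = 0 := fun j hj => hb0 j (hadm0 j hj)
  have hβz := (hβ.eq_zero_and_realObjective_le hγ₁ hγ₂ hl heta0 hn hadm).1
  have hbd : ∀ j, |(b - βstar) j| ≤ Q * (ρ / n) := fun j => by
    by_cases hj : βstar j = 0
    · rw [Pi.sub_apply, hb0 j hj, hj, sub_zero, abs_zero]
      positivity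
    · rw [Pi.sub_apply, hb1 j hj]
      exact hcoord j
  have hscore : ∀ j, |((X n)ᵀ *ᵥ e - ((X n)ᵀ * X n) *ᵥ (b - βstar)) j| ≤ R * ρ :=
    fun j => by
      refine (abs_score_le ha he hbd j).trans ?_
      have h1 : (p : ℝ) * (a * n * (Q * (ρ / n))) = p * (a * Q) * ρ := by field_simp
      have h2 : 0 ≤ K * (lam n + eta n) := by positivity
      rw [h1, hR]
      nlinarith
  have hβb : β = b := by
    refine eq_of_penaltyIncrement_ge hγ₁ hγ₂ hl heta0 hn hβ hadm hscore fun j => ?_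
    by_cases hj : βstar j = 0
    · refine penaltyIncrement_ge_of_init_small hγ₁ hγ₂ hl.le heta0 hK hspos
        (by simpa [hj] using hinit j) (hβz j) (hb0 j hj) (le_trans ?_ hoff)
      rw [mul_assoc]
      refine mul_le_mul_of_nonneg_left ?_ (by positivity)
      have h1 : eta n / √(m n : ℝ) ^ γ₂ ≤ ρ :=
        (div_le_self heta0 (Real.one_le_rpow hs1 hγ₂)).trans (by linarith)
      have h2 : K ^ γ₂ * (eta n / √(m n : ℝ) ^ γ₂) ≤ K ^ γ₂ * ρ := by gcongr
      linarith
    · simp [penaltyIncrement, hb1 j hj]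
  ext j
  rw [Function.mem_support, Function.mem_support]
  refine ⟨fun hne h0 => hne (hβb ▸ hb0 j h0), fun hj h0 => ?_⟩
  have h1 := (hcoord j).trans_lt (hcons j hj)
  rw [h0, zero_sub, abs_neg] at h1
  exact lt_irrefl _ h1

end Selection

/-! ### Tightness of the initial estimator and of the score -/

section Probability

variable {Ω : Type*} [MeasurableSpace Ω] {μ : Measure Ω} [IsProbabilityMeasure μ] {p : ℕ}

/-- A sequence which converges in distribution is eventually bounded up to small probability. -/
lemma eventually_measure_norm_gt_le {E : Type*} [NormedAddCommGroup E] [MeasurableSpace E]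
    [BorelSpace E] [SecondCountableTopology E] [CompleteSpace E]
    {Z : ℕ → Ω → E} {ν : Measure E} [IsProbabilityMeasure ν]
    (hZ : TendstoInDistribution Z atTop id (fun _ => μ) ν) {δ : ℝ≥0∞} (hδ : 0 < δ) :
    ∃ K₀ : ℝ, ∀ K ≥ K₀, ∀ᶠ n in atTop, μ {ω | K < ‖Z n ω‖} ≤ δ := by
  have ht := tendsto_measure_norm_gt_of_isTightMeasureSet (isTightMeasureSet_singleton (μ := ν))
  obtain ⟨r, hr⟩ := (ht.eventually_lt_const hδ).exists
  simp only [Set.mem_singleton_iff, iSup_iSup_eq_left] at hr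
  -- The portmanteau bound needs the closed set `K ≤ ‖x‖`; the margin places it inside `r < ‖x‖`.
  refine ⟨r + 1, fun K hK => ?_⟩
  have hclosed : IsClosed {x : E | K ≤ ‖x‖} := isClosed_le continuous_const continuous_norm
  have hlim := ProbabilityMeasure.limsup_measure_closed_le_of_tendsto hZ.tendsto hclosed
  have hlt : ν {x : E | K ≤ ‖x‖} < δ := by
    refine lt_of_le_of_lt (measure_mono fun x hx => ?_) hr
    have hx' : K ≤ ‖x‖ := hx
    change r < ‖x‖
    linarith
  simp only [ProbabilityMeasure.coe_mk, Measure.map_id] at hlim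
  filter_upwards [eventually_lt_of_limsup_lt (hlim.trans_lt hlt)] with n hn
  rw [Measure.map_apply_of_aemeasurable (hZ.forall_aemeasurable n) hclosed.measurableSet] at hn
  exact (measure_mono fun ω (hω : K < ‖Z n ω‖) => hω.le).trans hn.le

variable {X : (n : ℕ) → Matrix (Fin n) (Fin p) ℝ} {σ : ℝ≥0} {ε : (n : ℕ) → Ω → Fin n → ℝ}

/-- Chebyshev's inequality for a linear combination of independent centred Gaussian variables. -/
lemma measure_dotProduct_ge_le {n : ℕ} {e : Ω → Fin n → ℝ}
    (hlaw : ∀ i, HasLaw (fun ω => e ω i) (gaussianReal 0 (σ ^ 2)) μ)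
    (hindep : iIndepFun (fun (i : Fin n) ω => e ω i) μ) (w : Fin n → ℝ) {t : ℝ} (ht : 0 < t) :
    μ {ω | t ≤ |w ⬝ᵥ e ω|} ≤ ENNReal.ofReal ((σ : ℝ) ^ 2 * (w ⬝ᵥ w) / t ^ 2) := by
  have hmem : ∀ i, MemLp (fun ω => e ω i) 2 μ := fun i => by
    have h : MemLp id 2 (μ.map fun ω => e ω i) := by
      rw [(hlaw i).map_eq]
      exact memLp_id_gaussianReal 2
    exact (memLp_map_measure_iff h.aestronglyMeasurable (hlaw i).aemeasurable).1 h
  have hmemw : ∀ i, MemLp (fun ω => w i * e ω i) 2 μ := fun i => (hmem i).const_mul (w i)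
  have hfun : (fun ω => w ⬝ᵥ e ω) = ∑ i, fun ω => w i * e ω i := by
    ext ω
    simp [dotProduct]
  have hmem' : MemLp (fun ω => w ⬝ᵥ e ω) 2 μ := by
    rw [hfun]
    exact memLp_finsetSum' _ fun i _ => hmemw i
  have hmean : ∫ ω, w ⬝ᵥ e ω ∂μ = 0 := by
    simp only [dotProduct]
    rw [integral_finsetSum _ fun i _ => (hmemw i).integrable one_le_two]
    refine Finset.sum_eq_zero fun i _ => ?_
    rw [integral_const_mul, (hlaw i).integral_eq, integral_id_gaussianReal, mul_zero]
  have hvar : Var[fun ω => w ⬝ᵥ e ω; μ] = (σ : ℝ) ^ 2 * (w ⬝ᵥ w) := by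
    rw [hfun, IndepFun.variance_sum (fun i _ => hmemw i)]
    · rw [dotProduct, Finset.mul_sum]
      refine Finset.sum_congr rfl fun i _ => ?_
      rw [variance_const_mul, (hlaw i).variance_eq, variance_id_gaussianReal]
      push_cast
      ring
    · intro i _ j _ hij
      exact (hindep.indepFun hij).comp (measurable_const_mul (w i)) (measurable_const_mul (w j))
  have h := meas_ge_le_variance_div_sq hmem' ht
  rw [hmean, hvar] at h
  simpa only [sub_zero] using h

/-- Each coordinate of `Xᵀ ε` has variance `σ²` times a diagonal Gram entry, hence `O(n)`; Chebyshev
and a union bound over the `p` coordinates finish. -/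
lemma eventually_measure_score_gt_le
    (hlaw : ∀ n i, HasLaw (fun ω => ε n ω i) (gaussianReal 0 (σ ^ 2)) μ)
    (hindep : ∀ n, iIndepFun (fun (i : Fin n) ω => ε n ω i) μ) {a : ℝ}
    (ha : ∀ᶠ n : ℕ in atTop, ∀ j k, |((X n)ᵀ * X n) j k| ≤ a * n) {δ : ℝ≥0∞} (hδ : 0 < δ) :
    ∃ K₀ : ℝ, ∀ K ≥ K₀, ∀ᶠ n : ℕ in atTop,
      μ {ω | ¬ ∀ j, |((X n)ᵀ *ᵥ ε n ω) j| ≤ K * √(n : ℝ)} ≤ δ := by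
  have hlim : Tendsto (fun K : ℝ => ∑ _j : Fin p, ENNReal.ofReal ((σ : ℝ) ^ 2 * a / K ^ 2)) atTop
      (𝓝 0) := by
    have h1 : Tendsto (fun K : ℝ => (σ : ℝ) ^ 2 * a / K ^ 2) atTop (𝓝 0) :=
      (tendsto_pow_atTop two_ne_zero).const_div_atTop _
    have h2 := tendsto_finsetSum (Finset.univ : Finset (Fin p))
      fun _ _ => ENNReal.tendsto_ofReal h1
    simpa using h2
  obtain ⟨K₀, hK₀⟩ := eventually_atTop.1
    ((hlim.eventually_lt_const hδ).and (eventually_gt_atTop 0))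
  refine ⟨K₀, fun K hK => ?_⟩
  obtain ⟨hsum, hKpos⟩ := hK₀ K hK
  filter_upwards [ha, eventually_gt_atTop 0] with n ha hn
  have hn' : (0 : ℝ) < n := by exact_mod_cast hn
  have hsq : 0 < √(n : ℝ) := Real.sqrt_pos.2 hn'
  refine le_trans ?_ hsum.le
  have hsub : {ω | ¬ ∀ j, |((X n)ᵀ *ᵥ ε n ω) j| ≤ K * √(n : ℝ)}
      ⊆ ⋃ j, {ω | K * √(n : ℝ) ≤ |(X n)ᵀ j ⬝ᵥ ε n ω|} := by
    intro ω hω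
    obtain ⟨j, hj⟩ := not_forall.1 hω
    exact Set.mem_iUnion.2 ⟨j, (not_le.1 hj).le⟩
  refine (measure_mono hsub).trans ((measure_iUnion_fintype_le μ _).trans
    (Finset.sum_le_sum fun j _ => ?_))
  refine (measure_dotProduct_ge_le (hlaw n) (hindep n) _ (by positivity)).trans
    (ENNReal.ofReal_le_ofReal ?_)
  have hjj : (X n)ᵀ j ⬝ᵥ (X n)ᵀ j ≤ a * n := (le_abs_self _).trans (ha j j)
  rw [mul_pow, Real.sq_sqrt hn'.le]
  calc (σ : ℝ) ^ 2 * ((X n)ᵀ j ⬝ᵥ (X n)ᵀ j) / (K ^ 2 * n)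
      ≤ (σ : ℝ) ^ 2 * (a * n) / (K ^ 2 * n) := by gcongr
    _ = _ := by field_simp

end Probability

end AdaptiveTransferLasso

/-! ### From deterministic recovery to probability tending to one -/

theorem mainTheorem3
    {Ω : Type*} [MeasurableSpace Ω] (μ : Measure Ω) [IsProbabilityMeasure μ]
    (p : ℕ) (βstar : Fin p → ℝ)
    -- the design matrices and their limit
    (X : (n : ℕ) → Matrix (Fin n) (Fin p) ℝ) (C : Matrix (Fin p) (Fin p) ℝ)
    (hC : C.PosDef)
    (hXC : Tendsto (fun n : ℕ => (1 / (n : ℝ)) • ((X n)ᵀ * X n)) atTop (𝓝 C))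
    (hXmax : Tendsto (fun n : ℕ => (1 / (n : ℝ)) * ⨆ i : Fin n, ∑ j, X n i j ^ 2) atTop (𝓝 0))
    -- the i.i.d. Gaussian noise
    (σ : ℝ≥0) (ε : (n : ℕ) → Ω → Fin n → ℝ)
    (hεlaw : ∀ n i, HasLaw (fun ω => ε n ω i) (gaussianReal 0 (σ ^ 2)) μ)
    (hεindep : ∀ n, iIndepFun (fun (i : Fin n) ω => ε n ω i) μ)
    -- the source sample size and the initial estimator
    (m : ℕ → ℕ) (hm : ∀ᶠ n in atTop, 0 < m n)
    (r₀ : ℝ) (hr₀ : 0 ≤ r₀) (hnm : Tendsto (fun n : ℕ => (n : ℝ) / (m n : ℝ)) atTop (𝓝 r₀))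
    (βinit : ℕ → Ω → Fin p → ℝ)
    (hindep : ∀ n, IndepFun (ε n) (βinit n) μ)
    (ν : Measure (Fin p → ℝ)) [IsProbabilityMeasure ν]
    (hz : TendstoInDistribution (fun n ω => √(m n : ℝ) • (βinit n ω - βstar)) atTop id
      (fun _ => μ) ν)
    -- the hyperparameters
    (γ₁ γ₂ : ℝ) (hγ₁ : 0 ≤ γ₁) (hγ₂ : 0 ≤ γ₂)
    (lam eta : ℕ → ℝ) (hlam : ∀ n, 0 ≤ lam n) (heta : ∀ n, 0 ≤ eta n)
    (hregime : AdaptiveTransferLasso.RootMRegime m lam eta γ₁ γ₂ ∨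
      AdaptiveTransferLasso.RootNRegime m lam eta γ₁ ∨
      (0 < γ₁ ∧ AdaptiveTransferLasso.SubRootNRegime lam eta))
    -- the Adaptive Transfer Lasso estimator for the responses `y = X β* + ε`
    (βhat : ℕ → Ω → Fin p → ℝ) (hmeas : ∀ n, AEMeasurable (βhat n) μ)
    (hβhat : ∀ n, 0 < n → ∀ᵐ ω ∂μ, AdaptiveTransferLasso.IsEstimate (X n)
      (X n *ᵥ βstar + ε n ω) (lam n) (eta n) γ₁ γ₂ (βinit n ω) (βhat n ω)) :
    AdaptiveTransferLasso.ConsistentActiveSelection μ βhat βstar := by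
  have hs := AdaptiveTransferLasso.tendsto_sqrt_source hr₀ hm hnm
  obtain ⟨a, ha0, ha⟩ := AdaptiveTransferLasso.eventually_abs_gram_le hXC
  obtain ⟨c, hc, hquad⟩ := AdaptiveTransferLasso.eventually_gram_quadraticForm_ge hC hXC
  have hsel : ∀ K : ℝ, 0 < K → ∀ᶠ n in atTop,
      AdaptiveTransferLasso.SelectsWithin X βstar m lam eta γ₁ γ₂ K n := by
    intro K hK
    rcases hregime with h | h | ⟨hpos, h⟩
    · exact h.eventually_selectsWithin hγ₁ hγ₂ hlam heta hm hs
        (AdaptiveTransferLasso.eventually_natCast_le hm hnm) ha0 ha hK (Real.sqrt_nonneg _)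
    · exact h.dominated.eventually_selectsWithin hγ₁ hγ₂ hlam heta hs ha0 ha hc hquad hK
    · exact (h.dominated hpos hlam heta hs).eventually_selectsWithin hγ₁ hγ₂ hlam heta hs ha0 ha
        hc hquad hK
  refine (ENNReal.tendsto_nhds ENNReal.one_ne_top).2 fun δ hδ => ?_
  have hδ2 : 0 < δ / 2 := ENNReal.half_pos hδ.ne'
  obtain ⟨K₁, hK₁⟩ := AdaptiveTransferLasso.eventually_measure_norm_gt_le hz hδ2
  obtain ⟨K₂, hK₂⟩ := AdaptiveTransferLasso.eventually_measure_score_gt_le hεlaw hεindep ha hδ2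
  let K := max (max K₁ K₂) 1
  have hK : 0 < K := one_pos.trans_le (le_max_right _ _)
  filter_upwards [hK₁ K ((le_max_left _ _).trans (le_max_left _ _)),
    hK₂ K ((le_max_right _ _).trans (le_max_left _ _)), hsel K hK, hm, eventually_gt_atTop 0]
    with n h1 h2 hsel hmn hn
  refine ⟨?_, prob_le_one.trans le_self_add⟩
  have hspos : 0 < √(m n : ℝ) := Real.sqrt_pos.2 (by exact_mod_cast hmn)
  have hcompl : μ {ω | Function.support (βhat n ω) = Function.support βstar}ᶜ ≤ δ := by
    calc _ ≤ μ ({ω | K < ‖√(m n : ℝ) • (βinit n ω - βstar)‖}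
            ∪ {ω | ¬ ∀ j, |((X n)ᵀ *ᵥ ε n ω) j| ≤ K * √(n : ℝ)}) := by
          refine measure_mono_ae ?_
          filter_upwards [hβhat n hn] with ω hω hne
          by_contra hbad
          have hbad' := not_or.1 hbad
          refine hne (hsel (βinit n ω) (ε n ω) (βhat n ω) (fun j => ?_)
            (not_not.1 hbad'.2) hω)
          have h3 : ‖√(m n : ℝ) • (βinit n ω - βstar)‖ ≤ K := not_lt.1 hbad'.1
          rw [le_div_iff₀ hspos, mul_comm]
          refine le_trans ?_ ((norm_le_pi_norm _ j).trans h3)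
          rw [Pi.smul_apply, Pi.sub_apply, norm_smul, Real.norm_eq_abs, Real.norm_eq_abs,
            abs_of_pos hspos]
      _ ≤ δ / 2 + δ / 2 := (measure_union_le _ _).trans (add_le_add h1 h2)
      _ = δ := ENNReal.add_halves δ
  -- Only subadditivity enters, and it is valid for arbitrary sets.
  have huniv : (1 : ℝ≥0∞) ≤ μ {ω | Function.support (βhat n ω) = Function.support βstar}
      + μ {ω | Function.support (βhat n ω) = Function.support βstar}ᶜ := by
    rw [← measure_univ (μ := μ), ← Set.union_compl_self
      {ω | Function.support (βhat n ω) = Function.support βstar}]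
    exact measure_union_le _ _
  exact tsub_le_iff_right.2 (huniv.trans (by gcongr))
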